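/- Let $n,p,m_1,m_2$ be nonnegative integers and $m=m_1+m_2$. Let $\mathbb{S}^n$ be the space of real symmetric $n\times n$ matrices, with $A\bullet X=\operatorname{tr}(A^TX)$. Let $b\in\mathbb{R}^m$ be a fixed vector all of whose entries are nonzero. For $A=(A_1,\dots,A_m)\in(\mathbb{S}^n)^m$ let $$\mathscr{X}=\{X\in\mathbb{S}^n : X\succeq 0,\ (A_i\bullet X-b_i)_{i=1}^m\in\{0\}^{m_1}\times\mathbb{R}_+^{m_2}\},$$ and consider the Burer–Monteiro problem $$(BM)\qquad \min_{Y\in\mathbb{R}^{n\times p}} C\bullet YY^T\quad\text{such that } YY^T\in\mathscr{X},$$ where $C\in\mathbb{S}^n$; its feasible set does not depend on $C$. For $i=1,\dots,m$ let $h_i(Y)=A_i\bullet YY^T-b_i$ for $Y\in\mathbb{R}^{n\times p}$. Then for generic $A$, that is, for all $A\in(\mathbb{S}^n)^m$ outside a set of Lebesgue measure zero, every feasible point $Y$ of $(BM)$ satisfies LICQ: the gradients $\nabla h_i(Y)$ of the active constraints, i.e. of those $i\in\{1,\dots,m\}$ with $h_i(Y)=0$, are linearly independent. -/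

import Mathlib

open MeasureTheory
open scoped Matrix Gradient

noncomputable section

/-- The space `𝕊ⁿ` of real symmetric `n × n` matrices. -/
def SymMat (n : ℕ) : Submodule ℝ (Matrix (Fin n) (Fin n) ℝ) where
  carrier := {X | X.IsSymm}
  add_mem' hX hY := hX.add hY
  zero_mem' := Matrix.isSymm_zero
  smul_mem' c _ hX := hX.smul c

/-- `𝕊ⁿ` carries the Borel sigma-algebra of its topology as a finite-dimensional real
vector space. -/
instance (n : ℕ) : MeasurableSpace (SymMat n) := borel (SymMat n)

instance (n : ℕ) : BorelSpace (SymMat n) := ⟨rfl⟩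

/-- This makes the product sigma-algebra on tuples of symmetric matrices the Borel one. -/
instance (n : ℕ) : SecondCountableTopology (SymMat n) :=
  haveI : SecondCountableTopology (Matrix (Fin n) (Fin n) ℝ) :=
    inferInstanceAs (SecondCountableTopology (Fin n → Fin n → ℝ))
  TopologicalSpace.Subtype.secondCountableTopology _

/-- The trace inner product `A • X = tr (Aᵀ X)`. -/
def frobInner {n : ℕ} (A X : Matrix (Fin n) (Fin n) ℝ) : ℝ := (Aᵀ * X).trace

/-- The linear map `𝒜 : 𝕊ⁿ → ℝᵐ`, `X ↦ (A₁ • X, …, Aₘ • X)`. -/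
def constraintMap {n m : ℕ} (A : Fin m → SymMat n) : SymMat n →ₗ[ℝ] (Fin m → ℝ) where
  toFun X i := frobInner (A i).1 X.1
  map_add' X Y := by ext i; simp [frobInner, Matrix.mul_add]
  map_smul' c X := by ext i; simp [frobInner]

/-- The cone `{0}^{m₁} × ℝ₊^{m₂}`. -/
def constraintCone (m₁ m₂ : ℕ) : Set (Fin (m₁ + m₂) → ℝ) :=
  {v | (∀ i : Fin m₁, v (Fin.castAdd m₂ i) = 0) ∧ ∀ j : Fin m₂, 0 ≤ v (Fin.natAdd m₁ j)}

/-- The feasible set `𝒳` of the semidefinite program: the positive semidefinite `X ∈ 𝕊ⁿ` with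
`𝒜(X) - b ∈ {0}^{m₁} × ℝ₊^{m₂}`. -/
def sdpFeasible {n m₁ m₂ : ℕ} (A : Fin (m₁ + m₂) → SymMat n) (b : Fin (m₁ + m₂) → ℝ) :
    Set (SymMat n) :=
  {X | X.1.PosSemidef ∧ constraintMap A X - b ∈ constraintCone m₁ m₂}

/-- `ℝ^{n×p}` with its standard Euclidean (Frobenius) inner product. -/
abbrev FactorSpace (n p : ℕ) : Type := EuclideanSpace ℝ (Fin n × Fin p)

/-- An element of `ℝ^{n×p}` as a matrix. -/
def toMat {n p : ℕ} (Y : FactorSpace n p) : Matrix (Fin n) (Fin p) ℝ :=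
  Matrix.of fun i j => Y (i, j)

/-- The symmetric matrix `Y Yᵀ`. -/
def gramSq {n p : ℕ} (Y : FactorSpace n p) : SymMat n :=
  ⟨toMat Y * (toMat Y)ᵀ, by
    show (toMat Y * (toMat Y)ᵀ)ᵀ = toMat Y * (toMat Y)ᵀ
    rw [Matrix.transpose_mul, Matrix.transpose_transpose]⟩

/-- The feasible set of the Burer–Monteiro problem: the `Y ∈ ℝ^{n×p}` with `Y Yᵀ ∈ 𝒳`. -/
def bmFeasible {n m₁ m₂ : ℕ} (p : ℕ) (A : Fin (m₁ + m₂) → SymMat n)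
    (b : Fin (m₁ + m₂) → ℝ) : Set (FactorSpace n p) :=
  {Y | gramSq Y ∈ sdpFeasible A b}

/-- The constraint functions `h_i(Y) = A_i • Y Yᵀ - b_i` of the Burer–Monteiro problem. -/
def bmConstraint {n m : ℕ} (p : ℕ) (A : Fin m → SymMat n) (b : Fin m → ℝ) (i : Fin m)
    (Y : FactorSpace n p) : ℝ :=
  constraintMap A (gramSq Y) i - b i

/-- The indices of the constraints that are active at `y`. -/
def activeSet {ι E : Type*} (h : ι → E → ℝ) (y : E) : Set ι := {i | h i y = 0}

/-- The linear independence constraint qualification at `y`: the gradients of the active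
constraints are linearly independent (as a family indexed by the active set). -/
def LICQ {ι E : Type*} [NormedAddCommGroup E] [InnerProductSpace ℝ E] [CompleteSpace E]
    (h : ι → E → ℝ) (y : E) : Prop :=
  LinearIndependent ℝ fun i : activeSet h y => ∇ (h i.1) y

end

/-!
The gradient of `h i` at `Y` is `2 • A i * Y`, so LICQ fails at a point `Y` only if there are
coefficients `l`, supported on the active constraints and not all zero, such that the symmetric
matrix `S = ∑ l i • A i` satisfies `S * Y = 0`. With `X = Y * Yᵀ` this gives a positive semidefinite
`X` with `S * X = 0` and `A i • X = b i` for all active `i`.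

The proof treats `b` as a second variable and shows that the set `dependentSet` of all pairs
`(A, c)` which admit such `X` and `l` is a null set (`measure_dependentSet`). Rescaling the `A i`
then reduces a fixed `b` to the slice over almost any `c`: for `c i = t i * b i` with all
`t i ≠ 0`, if LICQ fails for `(A, b)`, then `(t • A, c)` lies in `dependentSet`, and `A ↦ t • A`
preserves null sets. This is where `b i ≠ 0` enters.

That `dependentSet` is null is a dimension count. Normalize `l k = 1` for some `k`. Then `A k` is
determined by the other `A i`, by `l` and by `S`, and `c i = A i • X` is determined on the active
set, so the pair `(A, c)` is a smooth function of `A i` and one scalar for each `i ≠ k`, and of the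
pair `(S, X)`. It remains to see that the pairs of symmetric matrices with `S * X = 0` and `X`
positive semidefinite form a set whose dimension is not larger than that of the space of symmetric
matrices. After scaling `S` by a small `ε`, the nonzero eigenvalues of `X` are at least `2 * θ`
and those of `ε • S` at most `θ` (`exists_isSpectralTop`). If `P` is the projection onto the range of
`X`, then `X - θ • P` and `X - (2 * θ) • P` are the positive parts of `M - θ` and `M - 2 * θ`, where
`M = X + ε • S`. Positive parts are nonexpansive in the Frobenius norm
(`frobInner_posPart_sub_le`), so `X` is a Lipschitz function of `M`
(`IsSpectralTop.norm_sub_le_mul`). Altogether `dependentSet` is covered by countably many images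
of sets whose Hausdorff dimension is less than that of the ambient space, under continuously
differentiable maps.
-/

/-! ### Positive parts of symmetric matrices -/

theorem Matrix.PosSemidef.trace_mul_nonneg {n : ℕ} {U N : Matrix (Fin n) (Fin n) ℝ}
    (hU : U.PosSemidef) (hN : N.PosSemidef) : 0 ≤ (U * N).trace := by
  obtain ⟨B, rfl⟩ : ∃ B : Matrix (Fin n) (Fin n) ℝ, N = Bᴴ * B := by
    open scoped MatrixOrder in
    exact CStarAlgebra.nonneg_iff_eq_star_mul_self.mp hN.nonneg
  rw [← Matrix.mul_assoc, Matrix.trace_mul_comm, ← Matrix.mul_assoc]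
  exact (hU.mul_mul_conjTranspose_same B).trace_nonneg

theorem frobInner_eq_sum {n : ℕ} (A X : Matrix (Fin n) (Fin n) ℝ) :
    frobInner A X = ∑ i, ∑ j, A i j * X i j := by
  rw [frobInner, Matrix.trace, Finset.sum_comm]
  simp [Matrix.mul_apply]

/-- The positive part of a symmetric matrix is a nonexpansive function of the matrix, in the
Frobenius norm. Here the decomposition into positive and negative part is encoded by its
characterization: `U` and `N` are positive semidefinite with `U * N = 0`. -/
theorem frobInner_posPart_sub_le {n : ℕ} {U N U' N' : Matrix (Fin n) (Fin n) ℝ}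
    (hU : U.PosSemidef) (hN : N.PosSemidef) (hUN : U * N = 0)
    (hU' : U'.PosSemidef) (hN' : N'.PosSemidef) (hUN' : U' * N' = 0) :
    frobInner (U - U') (U - U') ≤
      frobInner ((U - N) - (U' - N')) ((U - N) - (U' - N')) := by
  set W := U - U' with hW
  set D := (U - N) - (U' - N') with hD
  have hWt : Wᵀ = W := by
    have h1 : Uᵀ = U := hU.1
    have h2 : U'ᵀ = U' := hU'.1
    rw [hW, Matrix.transpose_sub, h1, h2]
  have h1 : frobInner W W ≤ frobInner W D := by
    have e : frobInner W D = frobInner W W + (U * N').trace + (U' * N).trace := by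
      simp only [frobInner, hWt]
      rw [hW, hD, ← Matrix.trace_add, ← Matrix.trace_add]
      congr 1
      have : (U - U') * (U - N - (U' - N')) =
        (U - U') * (U - U') + U * N' + U' * N - U * N - U' * N' := by noncomm_ring
      rw [this, hUN, hUN']; simp
    have := hU.trace_mul_nonneg hN'
    have := hU'.trace_mul_nonneg hN
    linarith
  have h2 : 2 * frobInner W D ≤ frobInner W W + frobInner D D := by
    simp only [frobInner_eq_sum, Finset.mul_sum, ← Finset.sum_add_distrib]
    exact Finset.sum_le_sum fun i _ => Finset.sum_le_sum fun j _ => by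
      nlinarith [sq_nonneg (W i j - D i j)]
  linarith

/-! ### Recovering `X` from a sum `X + S` with `S * X = 0` -/

/-- Every nonzero eigenvalue of `X` is at least `2 * θ`, and `M` differs from `X` by a symmetric
matrix that vanishes on the range of `X` and has no eigenvalue above `θ`. This is encoded through
its consequence that, with `P` the projection onto the range of `X`, the positive part of `M - t`
is `X - t • P`, for `t = θ` and for `t = 2 * θ`. -/
def IsSpectralTop {n : ℕ} (θ : ℝ) (M X : Matrix (Fin n) (Fin n) ℝ) : Prop :=
  ∃ P : Matrix (Fin n) (Fin n) ℝ, ∀ t, t = θ ∨ t = 2 * θ →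
    (X - t • P).PosSemidef ∧ (X - t • P - (M - t • 1)).PosSemidef ∧
      (X - t • P) * (X - t • P - (M - t • 1)) = 0

section

-- The entrywise sup norm induces the topology that `SymMat n` already carries.
attribute [local instance] Matrix.normedAddCommGroup Matrix.normedSpace

/-- The Frobenius norm is at most `n` times the entrywise sup norm, and at least equal to it. -/
theorem norm_le_of_frobInner_le {n : ℕ} {W D : Matrix (Fin n) (Fin n) ℝ}
    (h : frobInner W W ≤ frobInner D D) : ‖W‖ ≤ n * ‖D‖ := by
  have hD : frobInner D D ≤ (n * ‖D‖) ^ 2 := by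
    rw [frobInner_eq_sum]
    calc ∑ i, ∑ j, D i j * D i j ≤ ∑ _i : Fin n, ∑ _j : Fin n, ‖D‖ ^ 2 := by
          refine Finset.sum_le_sum fun i _ => Finset.sum_le_sum fun j _ => ?_
          have := Matrix.norm_entry_le_entrywise_sup_norm D (i := i) (j := j)
          rw [Real.norm_eq_abs] at this
          rw [← sq, ← sq_abs]
          gcongr
      _ = (n * ‖D‖) ^ 2 := by simp; ring
  refine (Matrix.norm_le_iff (by positivity)).2 fun i j => ?_
  rw [Real.norm_eq_abs]
  refine abs_le_of_sq_le_sq ?_ (by positivity)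
  refine le_trans ?_ (h.trans hD)
  rw [frobInner_eq_sum, sq]
  calc W i j * W i j ≤ ∑ j, W i j * W i j :=
        Finset.single_le_sum (f := fun j => W i j * W i j)
          (fun j _ => mul_self_nonneg _) (Finset.mem_univ j)
    _ ≤ _ := Finset.single_le_sum (f := fun i => ∑ j, W i j * W i j)
          (fun i _ => Finset.sum_nonneg fun j _ => mul_self_nonneg _) (Finset.mem_univ i)

/-- `X` is a Lipschitz function of `M`, because it is the combination
`2 • (M - θ)₊ - (M - 2 * θ)₊` of positive parts, with the same constant for all `θ`. -/
theorem IsSpectralTop.norm_sub_le_mul {n : ℕ} {θ : ℝ} {M X M' X' : Matrix (Fin n) (Fin n) ℝ}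
    (h : IsSpectralTop θ M X) (h' : IsSpectralTop θ M' X') :
    ‖X - X'‖ ≤ 3 * n * ‖M - M'‖ := by
  obtain ⟨P, hP⟩ := h
  obtain ⟨P', hP'⟩ := h'
  have key : ∀ t, t = θ ∨ t = 2 * θ → ‖(X - t • P) - (X' - t • P')‖ ≤ n * ‖M - M'‖ := by
    intro t ht
    obtain ⟨a, b, c⟩ := hP t ht
    obtain ⟨a', b', c'⟩ := hP' t ht
    refine norm_le_of_frobInner_le ?_
    have := frobInner_posPart_sub_le a b c a' b' c'
    simpa using this
  have e : X - X' = (2 : ℝ) • ((X - θ • P) - (X' - θ • P')) -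
      ((X - (2 * θ) • P) - (X' - (2 * θ) • P')) := by
    module
  have h1 := key θ (Or.inl rfl)
  have h2 := key (2 * θ) (Or.inr rfl)
  rw [e]
  refine (norm_sub_le _ _).trans ?_
  rw [norm_smul, Real.norm_ofNat]
  linarith
end

theorem Matrix.IsHermitian.exists_eq_mul_diagonal_mul_transpose {n : ℕ}
    {H : Matrix (Fin n) (Fin n) ℝ} (hH : H.IsHermitian) :
    ∃ (Q : Matrix (Fin n) (Fin n) ℝ) (d : Fin n → ℝ), Qᵀ * Q = 1 ∧ Q * Qᵀ = 1 ∧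
      H = Q * Matrix.diagonal d * Qᵀ := by
  refine ⟨hH.eigenvectorUnitary, hH.eigenvalues, ?_, ?_, ?_⟩
  · exact Unitary.coe_star_mul_self hH.eigenvectorUnitary
  · exact Unitary.coe_mul_star_self hH.eigenvectorUnitary
  · exact hH.spectral_theorem

theorem posSemidef_mul_diagonal_mul_transpose {n : ℕ} (Q : Matrix (Fin n) (Fin n) ℝ)
    {d : Fin n → ℝ} (hd : ∀ i, 0 ≤ d i) : (Q * Matrix.diagonal d * Qᵀ).PosSemidef :=
  (Matrix.PosSemidef.diagonal (show 0 ≤ d from hd)).mul_mul_conjTranspose_same Q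

theorem exists_posSemidef_smul_one_sub {n : ℕ} {S : Matrix (Fin n) (Fin n) ℝ}
    (hS : S.IsHermitian) : ∃ C : ℝ, ∀ c, C ≤ c → (c • 1 - S).PosSemidef := by
  obtain ⟨Q, d, -, h2, rfl⟩ := hS.exists_eq_mul_diagonal_mul_transpose
  refine ⟨∑ i, |d i|, fun c hc => ?_⟩
  have e : c • 1 - Q * Matrix.diagonal d * Qᵀ = Q * Matrix.diagonal (fun i => c - d i) * Qᵀ := by
    have : Matrix.diagonal (fun i => c - d i) = c • 1 - Matrix.diagonal d := by
      ext i j; by_cases h : i = j <;> simp [h, Matrix.diagonal]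
    rw [this]; simp [Matrix.mul_sub, Matrix.sub_mul, h2]
  rw [e]
  refine posSemidef_mul_diagonal_mul_transpose Q fun i => ?_
  have := Finset.single_le_sum (f := fun i => |d i|) (fun i _ => abs_nonneg _) (Finset.mem_univ i)
  have := le_abs_self (d i)
  simp at *; linarith

open Filter Topology in
/-- If `S * X = 0` with `X` positive semidefinite, then after shrinking `S` a spectral gap separates
its eigenvalues from the nonzero eigenvalues of `X`. -/
theorem exists_isSpectralTop {n : ℕ} {X S : Matrix (Fin n) (Fin n) ℝ} (hX : X.PosSemidef)
    (hS : S.IsHermitian) (hSX : S * X = 0) :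
    ∃ j : ℕ, IsSpectralTop (1 / ((j : ℝ) + 1)) (X + (1 / ((j : ℝ) + 1)) ^ 2 • S) X := by
  obtain ⟨Q, d, h1, h2, hXd⟩ := hX.1.exists_eq_mul_diagonal_mul_transpose
  obtain ⟨C, hC⟩ := exists_posSemidef_smul_one_sub hS
  have hDX : Matrix.diagonal d = Qᵀ * X * Q := by
    rw [hXd, show Qᵀ * (Q * Matrix.diagonal d * Qᵀ) * Q =
      (Qᵀ * Q) * Matrix.diagonal d * (Qᵀ * Q) by simp only [Matrix.mul_assoc], h1]
    simp
  have hd : ∀ i, 0 ≤ d i := fun i => by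
    have := (hX.conjTranspose_mul_mul_same Q).diag_nonneg (i := i)
    rw [Matrix.conjTranspose_eq_transpose_of_trivial, ← hDX] at this
    simpa using this
  have hlim : Tendsto (fun j : ℕ => 1 / ((j : ℝ) + 1)) atTop (𝓝 0) :=
    tendsto_one_div_add_atTop_nhds_zero_nat
  have ev1 : ∀ᶠ j : ℕ in atTop, ∀ i, d i ≠ 0 → 2 * (1 / ((j : ℝ) + 1)) ≤ d i := by
    refine eventually_all.2 fun i => ?_
    by_cases hi : d i = 0
    · simp [hi]
    · have hpos : 0 < d i := lt_of_le_of_ne (hd i) (Ne.symm hi)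
      filter_upwards [hlim.eventually (gt_mem_nhds (half_pos hpos))] with j hj _
      linarith
  have ev2 : ∀ᶠ j : ℕ in atTop, C ≤ j := tendsto_natCast_atTop_atTop.eventually_ge_atTop C
  obtain ⟨j, hj1, hj2⟩ := (ev1.and ev2).exists
  refine ⟨j, ?_⟩
  set θ : ℝ := 1 / ((j : ℝ) + 1) with hθ
  have hθ0 : 0 < θ := by positivity
  -- the orthogonal projection onto the range of `X`; it factors through `X` since `0⁻¹ = 0`
  set P := Q * Matrix.diagonal (fun i => d i * (d i)⁻¹) * Qᵀ with hPdef
  have hPX : P = X * (Q * Matrix.diagonal (fun i => (d i)⁻¹) * Qᵀ) := by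
    rw [hXd, show Q * Matrix.diagonal d * Qᵀ * (Q * Matrix.diagonal (fun i => (d i)⁻¹) * Qᵀ) =
      Q * (Matrix.diagonal d * (Qᵀ * Q) * Matrix.diagonal (fun i => (d i)⁻¹)) * Qᵀ by
        simp only [Matrix.mul_assoc], h1]
    simp [hPdef]
  have hPt : Pᵀ = P := by
    rw [hPdef]; simp [Matrix.transpose_mul, Matrix.mul_assoc]
  have hXt : Xᵀ = X := hX.1
  have hSt : Sᵀ = S := hS
  have hSP : S * P = 0 := by rw [hPX, ← Matrix.mul_assoc, hSX, Matrix.zero_mul]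
  have hPS : P * S = 0 := by
    have := congrArg Matrix.transpose hSP
    simpa [Matrix.transpose_mul, hPt, hSt] using this
  have hXS : X * S = 0 := by
    have := congrArg Matrix.transpose hSX
    simpa [Matrix.transpose_mul, hXt, hSt] using this
  have hXP : X * P = X := by
    rw [hXd, hPdef, show Q * Matrix.diagonal d * Qᵀ *
      (Q * Matrix.diagonal (fun i => d i * (d i)⁻¹) * Qᵀ) =
      Q * (Matrix.diagonal d * (Qᵀ * Q) * Matrix.diagonal (fun i => d i * (d i)⁻¹)) * Qᵀ by
        simp only [Matrix.mul_assoc], h1]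
    simp only [Matrix.mul_one, Matrix.diagonal_mul_diagonal, mul_self_mul_inv, ← mul_assoc]
  have hPP : P * P = P := by
    have hPX' : P = (Q * Matrix.diagonal (fun i => (d i)⁻¹) * Qᵀ) * X := by
      rw [← hPt, hPX]; simp [Matrix.transpose_mul, Matrix.mul_assoc, hXt]
    rw [hPX', Matrix.mul_assoc, ← hPX', hXP, ← hPX']
  -- the negative part of `M - t` is `t • (1 - P) - θ ^ 2 • S`
  refine ⟨P, fun t ht => ?_⟩
  have htθ : θ ≤ t := by rcases ht with rfl | rfl <;> linarith
  have ht2 : t ≤ 2 * θ := by rcases ht with rfl | rfl <;> linarith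
  have eN : X - t • P - (X + θ ^ 2 • S - t • 1) = t • 1 - t • P - θ ^ 2 • S := by module
  rw [eN]
  refine ⟨?_, ?_, ?_⟩
  · have : X - t • P = Q * Matrix.diagonal (fun i => d i - t * (d i * (d i)⁻¹)) * Qᵀ := by
      have e : Matrix.diagonal (fun i => d i - t * (d i * (d i)⁻¹)) =
          Matrix.diagonal d - t • Matrix.diagonal (fun i => d i * (d i)⁻¹) := by
        ext i j; by_cases h : i = j <;> simp [h, Matrix.diagonal]
      rw [e, Matrix.mul_sub, Matrix.sub_mul, ← hXd]
      simp [hPdef]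
    rw [this]
    refine posSemidef_mul_diagonal_mul_transpose Q fun i => ?_
    by_cases hi : d i = 0
    · simp [hi]
    · rw [mul_inv_cancel₀ hi]
      have := hj1 i hi
      linarith
  · have e : t • 1 - t • P - θ ^ 2 • S = (1 - P) * (t • 1 - θ ^ 2 • S) * (1 - P)ᴴ := by
      rw [Matrix.conjTranspose_eq_transpose_of_trivial, Matrix.transpose_sub, hPt,
        Matrix.transpose_one]
      simp only [Matrix.sub_mul, Matrix.mul_sub, Matrix.one_mul, Matrix.mul_one,
        Matrix.smul_mul, Matrix.mul_smul, hPS, hSP, hPP, Matrix.zero_mul]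
      module
    rw [e]
    refine Matrix.PosSemidef.mul_mul_conjTranspose_same ?_ _
    have e2 : t • 1 - θ ^ 2 • S = θ ^ 2 • ((t / θ ^ 2) • 1 - S) := by
      rw [smul_sub, smul_smul]; congr 2; field_simp
    rw [e2]
    refine (hC _ ?_).smul (by positivity)
    calc C ≤ (j : ℝ) + 1 := by linarith
      _ = θ / θ ^ 2 := by rw [hθ]; field_simp
      _ ≤ t / θ ^ 2 := by gcongr
  · simp only [Matrix.sub_mul, Matrix.mul_sub, Matrix.mul_one,
        Matrix.smul_mul, Matrix.mul_smul, hPS, hXS, hXP, hPP]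
    module

/-! ### The exceptional pairs `(A, c)` form a null set -/

/-- The pairs `(A, c)` such that, for some positive semidefinite `X` and some set `I` of indices
with `A i • X = c i` for `i ∈ I`, a linear combination of the `A i` with `i ∈ I`, with coefficients
not all zero, annihilates `X`. With `X = Y * Yᵀ` these include all pairs for which LICQ fails
at `Y`. -/
def dependentSet (n m : ℕ) : Set ((Fin m → SymMat n) × (Fin m → ℝ)) :=
  {q | ∃ (X : SymMat n) (I : Finset (Fin m)) (l : Fin m → ℝ), X.1.PosSemidef ∧
    (∀ i ∈ I, frobInner (q.1 i).1 X.1 = q.2 i) ∧ (∃ k ∈ I, l k ≠ 0) ∧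
    (∑ i ∈ I, l i • q.1 i).1 * X.1 = 0}

section
attribute [local instance] Matrix.normedAddCommGroup Matrix.normedSpace

/-- The extension by `0` of a vector indexed by `i ≠ k` to all indices. -/
def extendZero {m : ℕ} (k : Fin m) (c : {i // i ≠ k} → ℝ) (i : Fin m) : ℝ :=
  if h : i ≠ k then c ⟨i, h⟩ else 0

/-- A parametrization of the part of `dependentSet n m` where the index set is `I` and the
coefficient of `A k` is `1`. The parameters are `((A, X), v)`: the entry `A k` holds the matrix
`X + ε • S`, where `S` is the linear combination that annihilates `X`, and `v i` holds the
coefficient of `A i` if `i ∈ I`, and the value `c i` otherwise. -/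
noncomputable def dependentParam {n m : ℕ} (k : Fin m) (I : Finset (Fin m)) (ε : ℝ)
    (u : ((Fin m → SymMat n) × SymMat n) × ({i // i ≠ k} → ℝ)) :
    (Fin m → SymMat n) × (Fin m → ℝ) :=
  let A := fun i => if i = k then
    ε⁻¹ • (u.1.1 k - u.1.2) - ∑ i ∈ I.erase k, extendZero k u.2 i • u.1.1 i else u.1.1 i
  (A, fun i => if i ∈ I then frobInner (A i).1 u.1.2.1 else extendZero k u.2 i)

theorem contDiff_extendZero {m : ℕ} (k i : Fin m) :
    ContDiff ℝ 1 fun c : {i // i ≠ k} → ℝ => extendZero k c i := by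
  unfold extendZero
  split_ifs
  · exact contDiff_apply _ _ _
  · exact contDiff_const

theorem contDiff_symMat_entry {n : ℕ} (i j : Fin n) :
    ContDiff ℝ 1 fun X : SymMat n => X.1 i j :=
  ((LinearMap.proj j ∘ₗ LinearMap.proj i ∘ₗ (SymMat n).subtype :
    SymMat n →ₗ[ℝ] ℝ).toContinuousLinearMap).contDiff

theorem contDiff_dependentParam {n m : ℕ} (k : Fin m) (I : Finset (Fin m)) (ε : ℝ) :
    ContDiff ℝ 1 (dependentParam (n := n) k I ε) := by
  have hext : ∀ i, ContDiff ℝ 1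
      fun u : ((Fin m → SymMat n) × SymMat n) × ({i // i ≠ k} → ℝ) => extendZero k u.2 i :=
    fun i => (contDiff_extendZero k i).comp contDiff_snd
  have hA : ∀ i, ContDiff ℝ 1
      fun u : ((Fin m → SymMat n) × SymMat n) × ({i // i ≠ k} → ℝ) => u.1.1 i :=
    fun i => (contDiff_apply ℝ (SymMat n) i).comp (contDiff_fst.comp contDiff_fst)
  have hX : ContDiff ℝ 1
      fun u : ((Fin m → SymMat n) × SymMat n) × ({i // i ≠ k} → ℝ) => u.1.2 :=
    contDiff_snd.comp contDiff_fst
  have hB : ∀ i, ContDiff ℝ 1 fun u => (dependentParam (n := n) k I ε u).1 i := by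
    intro i
    by_cases hi : i = k
    · simp only [dependentParam, hi, if_true]
      exact (((hA k).sub hX).const_smul ε⁻¹).sub
        (ContDiff.sum fun i _ => (hext i).smul (hA i))
    · simpa only [dependentParam, hi, if_false] using hA i
  refine (contDiff_pi.2 hB).prodMk (contDiff_pi.2 fun i => ?_)
  by_cases hi : i ∈ I
  · simp only [hi, if_true, frobInner_eq_sum]
    exact ContDiff.sum fun a _ => ContDiff.sum fun b _ =>
      ((contDiff_symMat_entry a b).comp (hB i)).mul ((contDiff_symMat_entry a b).comp hX)
  · simpa only [hi, if_false] using hext i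

/-- The parameters `((A, X), v)` of `dependentParam k I ε` for which `X` can be recovered from
`A k` in a Lipschitz way. -/
def gapSet (n m : ℕ) (k : Fin m) (θ : ℝ) :
    Set (((Fin m → SymMat n) × SymMat n) × ({i // i ≠ k} → ℝ)) :=
  {u | IsSpectralTop θ (u.1.1 k).1 u.1.2.1}

theorem dimH_gapSet_le (n m : ℕ) (k : Fin m) (θ : ℝ) :
    dimH (gapSet n m k θ) ≤
      Module.finrank ℝ ((Fin m → SymMat n) × ({i // i ≠ k} → ℝ)) := by
  -- `X` is a Lipschitz function of `A k`, so omitting `X` loses nothing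
  have huniq : ∀ u ∈ gapSet n m k θ, ∀ v ∈ gapSet n m k θ,
      ‖u.1.2 - v.1.2‖ ≤ 3 * n * ‖u.1.1 k - v.1.1 k‖ :=
    fun u hu v hv => IsSpectralTop.norm_sub_le_mul hu hv
  set p : ((Fin m → SymMat n) × SymMat n) × ({i // i ≠ k} → ℝ) →
    (Fin m → SymMat n) × ({i // i ≠ k} → ℝ) := fun u => (u.1.1, u.2) with hp
  choose! g hg using fun w (hw : w ∈ p '' gapSet n m k θ) => hw
  have hlip : LipschitzOnWith (max 1 (3 * n)) g (p '' gapSet n m k θ) := by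
    refine LipschitzOnWith.of_dist_le_mul fun w hw w' hw' => ?_
    obtain ⟨h1, h2⟩ := hg w hw
    obtain ⟨h1', h2'⟩ := hg w' hw'
    have h3 := huniq _ h1 _ h1'
    have e1 : (g w).1.1 = w.1 := congrArg Prod.fst h2
    have e2 : (g w).2 = w.2 := congrArg Prod.snd h2
    have e1' : (g w').1.1 = w'.1 := congrArg Prod.fst h2'
    have e2' : (g w').2 = w'.2 := congrArg Prod.snd h2'
    rw [e1, e1'] at h3
    have d1 : dist w.1 w'.1 ≤ dist w w' := le_max_left _ _
    have d2 : dist w.2 w'.2 ≤ dist w w' := le_max_right _ _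
    have d3 : dist (w.1 k) (w'.1 k) ≤ dist w w' := (dist_le_pi_dist w.1 w'.1 k).trans d1
    rw [← dist_eq_norm, ← dist_eq_norm] at h3
    have hd := dist_nonneg (x := w) (y := w')
    push_cast
    rw [Prod.dist_eq, Prod.dist_eq, e1, e1', e2, e2']
    have b1 : dist w w' ≤ max 1 (3 * (n : ℝ)) * dist w w' :=
      le_mul_of_one_le_left hd (le_max_left _ _)
    have b2 : 3 * (n : ℝ) * dist (w.1 k) (w'.1 k) ≤ max 1 (3 * (n : ℝ)) * dist w w' := by
      gcongr
      exact le_max_right _ _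
    exact max_le (max_le (d1.trans b1) (h3.trans b2)) (d2.trans b1)
  have hsub : gapSet n m k θ ⊆ g '' (p '' gapSet n m k θ) := by
    intro u hu
    refine ⟨p u, ⟨u, hu, rfl⟩, ?_⟩
    obtain ⟨h1, h2⟩ := hg (p u) ⟨u, hu, rfl⟩
    have e1 : (g (p u)).1.1 = u.1.1 := (congrArg Prod.fst h2 :)
    have e2 : (g (p u)).2 = u.2 := congrArg (fun w => w.2) h2
    have h3 := huniq _ h1 _ hu
    rw [e1] at h3
    have e3 : (g (p u)).1.2 = u.1.2 := by
      rw [← sub_eq_zero, ← norm_le_zero_iff]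
      simpa using h3
    exact Prod.ext (Prod.ext e1 e3) e2
  calc dimH (gapSet n m k θ) ≤ dimH (g '' (p '' gapSet n m k θ)) := dimH_mono hsub
    _ ≤ dimH (p '' gapSet n m k θ) := hlip.dimH_image_le
    _ ≤ dimH Set.univ := dimH_mono (Set.subset_univ _)
    _ = _ := Real.dimH_univ_eq_finrank _

/-- Countably many values of `ε` and `θ` suffice, all given by one natural number `j`. -/
theorem dependentSet_subset (n m : ℕ) :
    dependentSet n m ⊆ ⋃ (k : Fin m) (I : Finset (Fin m)) (j : ℕ),
      dependentParam k I ((1 / ((j : ℝ) + 1)) ^ 2) '' gapSet n m k (1 / ((j : ℝ) + 1)) := by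
  classical
  rintro ⟨A, c⟩ ⟨X, I, l, hX, hc, ⟨k, hk, hlk⟩, hl⟩
  -- the annihilating combination, normalized so that `A k` has coefficient `1`
  set S : SymMat n := ∑ i ∈ I, ((l k)⁻¹ * l i) • A i with hS
  have hSX : S.1 * X.1 = 0 := by
    have : S = (l k)⁻¹ • ∑ i ∈ I, l i • A i := by
      simp only [hS, Finset.smul_sum, smul_smul]
    rw [this, Submodule.coe_smul, Matrix.smul_mul, hl, smul_zero]
  obtain ⟨j, hj⟩ := exists_isSpectralTop hX (S := S.1) S.2 hSX
  simp only [Set.mem_iUnion]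
  refine ⟨k, I, j, ?_⟩
  set ε : ℝ := (1 / ((j : ℝ) + 1)) ^ 2 with hε
  have hε0 : ε ≠ 0 := by positivity
  refine ⟨((Function.update A k (X + ε • S), X),
    fun i => if i.1 ∈ I then (l k)⁻¹ * l i else c i), ?_, ?_⟩
  · simpa [gapSet] using hj
  · have hA : ∀ i, (if i = k then
        ε⁻¹ • (Function.update A k (X + ε • S) k - X) - ∑ i ∈ I.erase k,
          extendZero k (fun i => if i.1 ∈ I then (l k)⁻¹ * l i else c i) i •
            Function.update A k (X + ε • S) i else Function.update A k (X + ε • S) i) = A i := by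
      intro i
      by_cases hi : i = k
      · subst hi
        have : ∑ i' ∈ I.erase i,
          extendZero i (fun i' => if i'.1 ∈ I then (l i)⁻¹ * l i' else c i') i' •
            Function.update A i (X + ε • S) i' = ∑ i' ∈ I.erase i, ((l i)⁻¹ * l i') • A i' := by
          refine Finset.sum_congr rfl fun i' hi' => ?_
          obtain ⟨h1, h2⟩ := Finset.mem_erase.1 hi'
          simp [extendZero, h1, h2]
        rw [if_pos rfl, this, Function.update_self, add_sub_cancel_left, smul_smul,
          inv_mul_cancel₀ hε0, one_smul, hS, ← Finset.add_sum_erase _ _ hk, inv_mul_cancel₀ hlk]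
        simp
      · simp [hi]
    refine Prod.ext (funext hA) (funext fun i => ?_)
    simp only [dependentParam, hA]
    by_cases hi : i ∈ I
    · simpa [hi] using hc i hi
    · have : i ≠ k := fun h => hi (h ▸ hk)
      simp [hi, extendZero, this]

theorem addHaar_eq_zero_of_dimH_lt_finrank {E : Type*} [NormedAddCommGroup E] [NormedSpace ℝ E]
    [FiniteDimensional ℝ E] [MeasurableSpace E] [BorelSpace E] (ν : Measure E)
    [ν.IsAddHaarMeasure] {s : Set E} (hs : dimH s < Module.finrank ℝ E) : ν s = 0 := by
  have hac : ν ≪ Measure.hausdorffMeasure ((Module.finrank ℝ E : NNReal) : ℝ) := by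
    rw [NNReal.coe_natCast]
    exact Measure.absolutelyContinuous_isAddHaarMeasure _ _
  exact measure_zero_of_dimH_lt hac hs

theorem measure_dependentSet (n m : ℕ) (ν : Measure ((Fin m → SymMat n) × (Fin m → ℝ)))
    [ν.IsAddHaarMeasure] : ν (dependentSet n m) = 0 := by
  refine measure_mono_null (dependentSet_subset n m) ?_
  refine measure_iUnion_null fun k => measure_iUnion_null fun I => measure_iUnion_null fun j => ?_
  -- The instances are found for the topology of `SymMat n` as a subtype, which agrees with that of
  -- the norm only after unfolding.
  have hB : BorelSpace ((Fin m → SymMat n) × (Fin m → ℝ)) := Prod.borelSpace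
  have hν : ν.IsAddHaarMeasure := inferInstance
  refine @addHaar_eq_zero_of_dimH_lt_finrank _ _ _ _ _ (by exact hB) ν (by exact hν) _ ?_
  calc _ ≤ dimH (gapSet n m k (1 / ((j : ℝ) + 1))) :=
        (contDiff_dependentParam k I _).contDiffOn.dimH_image_le convex_univ (Set.subset_univ _)
    _ ≤ Module.finrank ℝ ((Fin m → SymMat n) × ({i // i ≠ k} → ℝ)) := dimH_gapSet_le n m k _
    _ < _ := by
        have : Fintype.card {i // i ≠ k} < Fintype.card (Fin m) :=
          Fintype.card_subtype_lt (x := k) (by simp)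
        rw [Module.finrank_prod, Module.finrank_prod, Module.finrank_fintype_fun_eq_card,
          Module.finrank_fintype_fun_eq_card]
        exact_mod_cast Nat.add_lt_add_left this _

end

/-! ### Failure of LICQ -/

theorem bmConstraint_eq_sum {n m : ℕ} (p : ℕ) (A : Fin m → SymMat n) (b : Fin m → ℝ) (i : Fin m)
    (Y : FactorSpace n p) :
    bmConstraint p A b i Y = ∑ r, ∑ s, (A i).1 r s * ∑ q, Y (r, q) * Y (s, q) - b i := by
  simp [bmConstraint, constraintMap, frobInner_eq_sum, gramSq, toMat, Matrix.mul_apply]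

theorem differentiable_bmConstraint {n m : ℕ} (p : ℕ) (A : Fin m → SymMat n) (b : Fin m → ℝ)
    (i : Fin m) : Differentiable ℝ (bmConstraint p A b i) := by
  have : bmConstraint p A b i =
      fun Y => ∑ r, ∑ s, (A i).1 r s * ∑ q, Y (r, q) * Y (s, q) - b i :=
    funext (bmConstraint_eq_sum p A b i)
  rw [this]
  fun_prop

/-- The gradient of `h i` at `Y` is `2 • A i * Y`, read off entry by entry. -/
theorem fderiv_bmConstraint_single {n m : ℕ} (p : ℕ) (A : Fin m → SymMat n) (b : Fin m → ℝ)
    (i : Fin m) (Y : FactorSpace n p) (r : Fin n) (q : Fin p) :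
    fderiv ℝ (bmConstraint p A b i) Y (EuclideanSpace.single (r, q) 1) =
      2 * ((A i).1 * toMat Y) r q := by
  set Z : FactorSpace n p := EuclideanSpace.single (r, q) 1 with hZ
  set E : Matrix (Fin n) (Fin p) ℝ := Matrix.single r q 1 with hE
  have hline : bmConstraint p A b i ∘ (fun t : ℝ => Y + t • Z) = fun t : ℝ =>
      bmConstraint p A b i Y + t * (2 * ((A i).1 * toMat Y) r q) +
        t ^ 2 * ((A i).1 * (E * Eᵀ)).trace := by
    funext t
    have hA : (A i).1ᵀ = (A i).1 := (A i).2
    have hYZ : toMat (Y + t • Z) = toMat Y + t • E := by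
      ext r' q'
      simp only [toMat, hZ, hE, Matrix.of_apply, PiLp.add_apply, PiLp.smul_apply,
        PiLp.single_apply, Matrix.add_apply, Matrix.smul_apply, Matrix.single_apply,
        Prod.mk.injEq, eq_comm]
    have h1 : ((A i).1 * (toMat Y * Eᵀ)).trace = ((A i).1 * toMat Y) r q := by
      rw [← Matrix.mul_assoc, hE, Matrix.transpose_single, Matrix.trace_mul_single]
      simp
    have h2 : ((A i).1 * (E * (toMat Y)ᵀ)).trace = ((A i).1 * toMat Y) r q := by
      rw [← h1, ← Matrix.trace_transpose, Matrix.transpose_mul, Matrix.transpose_mul, hA,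
        Matrix.transpose_transpose, Matrix.trace_mul_comm]
    simp only [Function.comp_apply, bmConstraint, constraintMap, LinearMap.coe_mk, AddHom.coe_mk,
      frobInner, gramSq, hYZ, hA, Matrix.transpose_add, Matrix.transpose_smul, Matrix.add_mul,
      Matrix.mul_add, Matrix.smul_mul, Matrix.mul_smul, Matrix.trace_add, Matrix.trace_smul,
      smul_eq_mul, h1, h2]
    ring
  have h1 := (differentiable_bmConstraint p A b i Y).hasFDerivAt.hasLineDerivAt Z
  have h2 : HasDerivAt (bmConstraint p A b i ∘ (fun t : ℝ => Y + t • Z))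
      (2 * ((A i).1 * toMat Y) r q) 0 := by
    rw [hline]
    have := (((hasDerivAt_id (0 : ℝ)).mul_const (2 * ((A i).1 * toMat Y) r q)).const_add
      (bmConstraint p A b i Y)).add
        ((hasDerivAt_pow 2 (0 : ℝ)).mul_const ((A i).1 * (E * Eᵀ)).trace)
    exact this.congr_deriv (by simp)
  exact HasDerivAt.unique h1 h2

theorem exists_sum_smul_mul_eq_zero_of_not_LICQ {n m p : ℕ} {A : Fin m → SymMat n}
    {b : Fin m → ℝ} {Y : FactorSpace n p} (h : ¬ LICQ (bmConstraint p A b) Y) :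
    ∃ (I : Finset (Fin m)) (l : Fin m → ℝ), (∀ i ∈ I, bmConstraint p A b i Y = 0) ∧
      (∃ k ∈ I, l k ≠ 0) ∧ (∑ i ∈ I, l i • A i).1 * toMat Y = 0 := by
  rw [LICQ, not_linearIndependent_iff] at h
  obtain ⟨s, g, hg, k, hk, hgk⟩ := h
  classical
  set l : Fin m → ℝ := fun i => if hi : i ∈ activeSet (bmConstraint p A b) Y then g ⟨i, hi⟩ else 0
    with hl
  have hl' : ∀ i : activeSet (bmConstraint p A b) Y, l i = g i := fun i => by simp [hl]
  refine ⟨s.map (Function.Embedding.subtype _), l, ?_, ⟨k, by simpa using hk, by rwa [hl']⟩, ?_⟩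
  · intro i hi
    obtain ⟨j, -, rfl⟩ := Finset.mem_map.1 hi
    exact j.2
  · rw [Finset.sum_map]
    ext r q
    have h0 := congrArg (fun v => inner ℝ v (EuclideanSpace.single (r, q) (1 : ℝ))) hg
    simp only [sum_inner, inner_smul_left, inner_zero_left, gradient,
      InnerProductSpace.toDual_symm_apply, fderiv_bmConstraint_single] at h0
    have h1 : ∑ i ∈ s, g i * ((A i).1 * toMat Y) r q = 0 := by
      have : ∑ i ∈ s, g i * (2 * ((A i).1 * toMat Y) r q) =
          2 * ∑ i ∈ s, g i * ((A i).1 * toMat Y) r q := by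
        rw [Finset.mul_sum]; exact Finset.sum_congr rfl fun i _ => by ring
      have h0' : ∑ i ∈ s, g i * (2 * ((A i).1 * toMat Y) r q) = 0 := by simpa using h0
      linarith
    simp only [Function.Embedding.subtype_apply, hl']
    rw [Submodule.coe_sum, Matrix.sum_mul, Matrix.sum_apply]
    simpa using h1

/-- If LICQ fails for `(A, b)`, then rescaling the constraints moves `(A, b)` into
`dependentSet n m`. -/
theorem mem_dependentSet_of_not_LICQ {n m p : ℕ} {A : Fin m → SymMat n} {b t : Fin m → ℝ}
    (ht : ∀ i, t i ≠ 0) {Y : FactorSpace n p} (h : ¬ LICQ (bmConstraint p A b) Y) :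
    ((fun i => t i • A i, fun i => t i * b i) : (Fin m → SymMat n) × (Fin m → ℝ)) ∈
      dependentSet n m := by
  obtain ⟨I, l, hI, ⟨k, hk, hlk⟩, hl⟩ := exists_sum_smul_mul_eq_zero_of_not_LICQ h
  refine ⟨gramSq Y, I, fun i => l i * (t i)⁻¹, ?_, fun i hi => ?_,
    ⟨k, hk, mul_ne_zero hlk (inv_ne_zero (ht k))⟩, ?_⟩
  · exact Matrix.posSemidef_self_mul_conjTranspose (toMat Y)
  · have : frobInner (A i).1 (gramSq Y).1 = b i := sub_eq_zero.1 (hI i hi)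
    simp only [frobInner] at this ⊢
    simp [this]
  · have e : ∑ i ∈ I, (l i * (t i)⁻¹) • t i • A i = ∑ i ∈ I, l i • A i :=
      Finset.sum_congr rfl fun i _ => by rw [smul_smul, inv_mul_cancel_right₀ (ht i)]
    simp only [e]
    change _ * (toMat Y * (toMat Y)ᵀ) = 0
    rw [← Matrix.mul_assoc, hl, Matrix.zero_mul]

/-! ### Genericity for fixed `b` -/

theorem locallyCompactSpace_symMat (n : ℕ) : LocallyCompactSpace (SymMat n) := by
  have : LocallyCompactSpace (Matrix (Fin n) (Fin n) ℝ) :=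
    inferInstanceAs (LocallyCompactSpace (Fin n → Fin n → ℝ))
  exact (SymMat n).closed_of_finiteDimensional.isClosedEmbedding_subtypeVal.locallyCompactSpace

/-- For almost every `A`, LICQ holds at every `Y`, feasible or not. -/
theorem ae_forall_LICQ {n m : ℕ} (p : ℕ) {b : Fin m → ℝ} (hb : ∀ i, b i ≠ 0)
    (μ : Measure (Fin m → SymMat n)) [μ.IsAddHaarMeasure] :
    ∀ᵐ A ∂μ, ∀ Y, LICQ (bmConstraint p A b) Y := by
  have := locallyCompactSpace_symMat n
  have : SigmaCompactSpace (Fin m → SymMat n) := inferInstance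
  have hν : (μ.prod (volume : Measure (Fin m → ℝ))).IsAddHaarMeasure := inferInstance
  have h0 : ∀ᵐ q ∂μ.prod (volume : Measure (Fin m → ℝ)), q ∉ dependentSet n m :=
    measure_eq_zero_iff_ae_notMem.1 (@measure_dependentSet n m _ (by exact hν))
  have h1 : ∀ᵐ c : Fin m → ℝ, ∀ᵐ A ∂μ, (A, c) ∉ dependentSet n m :=
    Measure.ae_ae_of_ae_prod (Measure.measurePreserving_swap.quasiMeasurePreserving.ae h0)
  have h2 : ∀ᵐ c : Fin m → ℝ, ∀ i, c i ≠ 0 :=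
    Filter.eventually_all.2 fun i => Measure.ae_eval_ne _ i 0
  -- one vector `c` without zero entries and with a null slice is enough
  obtain ⟨c, hc, hc0⟩ := (h1.and h2).exists
  have ht : ∀ i, c i / b i ≠ 0 := fun i => div_ne_zero (hc0 i) (hb i)
  let T : (Fin m → SymMat n) ≃L[ℝ] (Fin m → SymMat n) :=
    ContinuousLinearEquiv.piCongrRight fun i =>
      ContinuousLinearEquiv.smulLeft (Units.mk0 (c i / b i) (ht i))
  have hT : Measure.QuasiMeasurePreserving T μ μ := by
    refine ⟨T.continuous.measurable, ?_⟩
    have : (μ.map T).IsAddHaarMeasure := T.isAddHaarMeasure_map μ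
    exact Measure.absolutelyContinuous_isAddHaarMeasure _ _
  filter_upwards [hT.ae hc] with A hA Y
  by_contra hY
  refine hA ?_
  have h3 := mem_dependentSet_of_not_LICQ ht hY
  have h4 : (fun i => c i / b i * b i) = c := funext fun i => div_mul_cancel₀ _ (hb i)
  rwa [h4] at h3

/-- "Generic" means: outside a null set of the space `(𝕊ⁿ)ᵐ` of tuples `(A₁, …, Aₘ)`, for
Lebesgue measure, which is the additive Haar measure, unique up to a positive factor. -/
theorem mainTheorem6 (n p m₁ m₂ : ℕ) (b : Fin (m₁ + m₂) → ℝ) (hb : ∀ i, b i ≠ 0)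
    (μ : Measure (Fin (m₁ + m₂) → SymMat n)) [μ.IsAddHaarMeasure] :
    ∀ᵐ A ∂μ, ∀ Y ∈ bmFeasible p A b, LICQ (bmConstraint p A b) Y := by
  filter_upwards [ae_forall_LICQ p hb μ] with A hA Y _
  exact hA Y
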